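/- Let $k$ be a positive integer. A $k$-edge-coloring of a graph is any map from its edges to $[k]=\{1,\dots,k\}$ (not necessarily proper or surjective). For a graph $H$, the Gallai–Ramsey number $gr_k(K_3:H)$ is the smallest integer $n$ such that every $k$-edge-colored complete graph $K_n$ contains a rainbow triangle (a triangle whose three edges have pairwise distinct colors) or a monochromatic copy (as a subgraph) of $H$. For integers $0\le s\le N$, let $K_N\sqcup K_{1,s}$ be the graph obtained from $K_N$ by adding one new vertex and joining it to exactly $s$ vertices of $K_N$. With $n=gr_k(K_3:H)$, the star-critical Gallai–Ramsey number $gr_k^*(K_3:H)$ is the smallest integer $s$ with $0\le s\le n-1$ such that every $k$-edge-colored $K_{n-1}\sqcup K_{1,s}$ contains a rainbow triangle or a monochromatic copy of $H$. **Theorem.** For every integer $k\ge 3$, $$gr_k^*(K_3:K_{1,m})=\begin{cases}2m-2, & \text{if } m\ge 12 \text{ is even},\\ m, & \text{if } m\ge 3\text{ is odd},\end{cases}$$ where $K_{1,m}$ is the star with $m$ edges. -/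

import Mathlib

/-- An edge coloring `c` of `G` contains a rainbow triangle: three pairwise adjacent vertices whose
three edges receive pairwise distinct colors. -/
def HasRainbowTriangle {V K : Type*} {G : SimpleGraph V} (c : G.EdgeLabeling K) : Prop :=
  ∃ (x y z : V) (hxy : G.Adj x y) (hyz : G.Adj y z) (hxz : G.Adj x z),
    c.get x y hxy ≠ c.get y z hyz ∧ c.get x y hxy ≠ c.get x z hxz ∧ c.get y z hyz ≠ c.get x z hxz

/-- Every `k`-edge-coloring of `G` (an arbitrary map from the edges to the `k` colors, not required
to be proper or to use all colors) contains a rainbow triangle or, for some color `i`, a copy (not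
necessarily induced) of `H i` all of whose edges have color `i`. -/
def GallaiArrows {V : Type*} (G : SimpleGraph V) {k : ℕ} {W : Fin k → Type*}
    (H : ∀ i, SimpleGraph (W i)) : Prop :=
  ∀ c : G.EdgeLabeling (Fin k), HasRainbowTriangle c ∨ ∃ i, (H i).IsContained (c.labelGraph i)

/-- `n = gr_k(K₃ : H₁, …, H_k)`: the smallest `n` such that every `k`-edge-colored `K_n` contains a
rainbow triangle or a monochromatic `H i` in color `i` for some `i`. -/
def IsGallaiRamseyNumber {k : ℕ} {W : Fin k → Type*} (H : ∀ i, SimpleGraph (W i)) (n : ℕ) : Prop :=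
  IsLeast {n : ℕ | GallaiArrows (⊤ : SimpleGraph (Fin n)) H} n

/-- The graph obtained from the complete graph on `Fin N` by adding one new vertex `none` and
joining it exactly to the vertices in `S`. If `S` has `s` elements, this is `K_N ⊔ K_{1,s}`. -/
def completeAddVertex (N : ℕ) (S : Finset (Fin N)) : SimpleGraph (Option (Fin N)) where
  Adj
    | some a, some b => a ≠ b
    | none, some b => b ∈ S
    | some a, none => a ∈ S
    | none, none => False
  symm := ⟨by rintro (_ | a) (_ | b) h <;> first | exact h | exact Ne.symm h⟩
  loopless := ⟨by rintro (_ | a) h; exacts [h, h rfl]⟩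

/-- `s = gr_k^*(K₃ : H₁, …, H_k)`: with `n = gr_k(K₃ : H₁, …, H_k)`, the number `s` is the smallest
integer in `{0, …, n - 1}` such that every `k`-edge-colored `K_{n-1} ⊔ K_{1,s}` contains a rainbow
triangle or a monochromatic `H i` in color `i` for some `i`. -/
def IsStarCriticalGallaiRamseyNumber {k : ℕ} {W : Fin k → Type*} (H : ∀ i, SimpleGraph (W i))
    (s : ℕ) : Prop :=
  ∃ n : ℕ, IsGallaiRamseyNumber H n ∧
    IsLeast {s : ℕ | s ≤ n - 1 ∧ ∀ S : Finset (Fin (n - 1)), S.card = s →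
      GallaiArrows (completeAddVertex (n - 1) S) H} s

/-- The star `K_{1,m}`. -/
abbrev starK (m : ℕ) : SimpleGraph (Fin 1 ⊕ Fin m) :=
  completeBipartiteGraph (Fin 1) (Fin m)

/-!
Write `m = 2 t + 1` in the odd case, where the Gallai–Ramsey number is `5 t + 1`, and `m = 2 t + 2`
in the even case, where it is `5 t + 2`. A coloring without a monochromatic star is one with color
degrees at most `d = m - 1`, that is `2 t` or `2 t + 1`.

The upper bounds rest on the module structure of a Gallai coloring of the complete graph on
`N = 5 t` or `5 t + 1` vertices. When the colors are merged into three classes, one class fails to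
connect the vertices (`IsGallai.exists_not_reach`). Applied to the coloring in which an
inclusion-maximal proper module `A` is contracted to a point, this shows that at most two colors
leave `A`: otherwise a component of the disconnected class would give a larger module. A single
color is impossible, as it would cut the vertex set with one color and force a color degree of at
least `N / 2`. So the vertices outside `A` form two sides `R` and `B`, joined to `A` in colors `ρ`
and `β` respectively, and all edges between `R` and `B` have color `ρ` or `β`. A vertex of `R` has
at most `d - |A|` edges of color `ρ` to `B`, and symmetrically, whence
`|R| |B| ≤ (|R| + |B|) (d - |A|)` (`IsSplit.card_mul_card_le`).

For odd `m` this gives `|A| = t` and `|R| = |B| = 2 t`, so every vertex is saturated in the two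
colors leaving its module. The edges from a new vertex to two different modules must then have the
same color, and a new vertex of degree `2 t + 1` is impossible (`IsExtension.false_of_odd`).

For even `m` with `t ≥ 5` it gives `t - 1 ≤ |A| ≤ t + 1`. Two maximal modules together have at most
`d` vertices, and each side of a module consists of at most two modules. Counting yields a module
with `t + 1` vertices whose sides have `2 t` vertices each (`exists_isSplit_of_even`), where the
count of edges between the sides is tight. This determines the colors of the edges at a new vertex
of degree `4 t + 2` up to a contradiction inside the module (`IsExtension.false_of_even`).

The lower bounds come from blow-ups of the `2`-colored pentagon with a third color inside the parts
(`not_gallaiArrows_of_odd`, `not_gallaiArrows_of_even`). One such coloring with a new vertex of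
degree `s - 1` shows both that the Gallai–Ramsey number exceeds `N` and that the star-critical
number is at least `s`.
-/

open Finset

/-! ### Gallai colorings and modules -/

/-- A coloring `c` of the pairs of elements of `V` (the diagonal values are irrelevant) that is
symmetric and has no rainbow triangle. -/
structure IsGallai {V K : Type*} (c : V → V → K) : Prop where
  symm : ∀ x y, c x y = c y x
  noRainbow : ∀ x y z, x ≠ y → y ≠ z → x ≠ z →
    c x y = c y z ∨ c x y = c x z ∨ c y z = c x z

/-- `w` can be reached from `u` inside `W` along edges whose color satisfies `P`. -/
def Reach {V K : Type*} (c : V → V → K) (P : K → Prop) (W : Finset V) : V → V → Prop :=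
  Relation.ReflTransGen fun u w => u ∈ W ∧ w ∈ W ∧ P (c u w)

/-- `A` is a module: every vertex outside `A` sends a single color to `A`. -/
def IsModule {V K : Type*} (c : V → V → K) (A : Finset V) : Prop :=
  ∀ y ∉ A, ∀ a ∈ A, ∀ a' ∈ A, c y a = c y a'

/-- `A` is inclusion-maximal among the nonempty modules different from the whole vertex set. -/
structure IsMaxModule {V K : Type*} [Fintype V] (c : V → V → K) (A : Finset V) : Prop where
  nonempty : A.Nonempty
  isModule : IsModule c A
  ne_univ : A ≠ univ
  eq_of_subset : ∀ C, IsModule c C → C ≠ univ → A ⊆ C → C = A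

section

variable {V K : Type*} {c : V → V → K}

/-! ### Disconnected color classes -/

theorem Reach.symm (hG : IsGallai c) {P : K → Prop} {W : Finset V} {u w : V}
    (h : Reach c P W u w) : Reach c P W w u := by
  induction h with
  | refl => exact .refl
  | tail _ hyz ih => exact .head ⟨hyz.2.1, hyz.1, by rw [hG.symm]; exact hyz.2.2⟩ ih

/-- A vertex outside a component of the color class `P` sends a single color to that component. -/
theorem IsGallai.eq_of_reach (hG : IsGallai c) {P : K → Prop} {W : Finset V} {x u w : V}
    (hx : x ∈ W) (hxu : ¬ Reach c P W x u) (huw : Reach c P W u w) : c x u = c x w := by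
  induction huw with
  | refl => rfl
  | @tail y z huy hyz ih =>
    have hxy : ¬ Reach c P W x y := fun h => hxu (h.trans (Reach.symm hG huy))
    have hxz : ¬ Reach c P W x z := fun h =>
      hxu (h.trans (Reach.symm hG (Relation.ReflTransGen.tail huy hyz)))
    have h1 : ¬ P (c x y) := fun h => hxy (.single ⟨hx, hyz.1, h⟩)
    have h2 : ¬ P (c x z) := fun h => hxz (.single ⟨hx, hyz.2.1, h⟩)
    have h3 : x ≠ y := by rintro rfl; exact hxy .refl
    have h4 : x ≠ z := by rintro rfl; exact hxz .refl
    rw [ih]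
    by_cases hyz' : y = z
    · rw [hyz']
    rcases hG.noRainbow x y z h3 hyz' h4 with h | h | h
    · exact absurd (h ▸ hyz.2.2) h1
    · exact h
    · exact absurd (h ▸ hyz.2.2) h2

theorem Reach.exists_adj [DecidableEq V] {P : K → Prop} {W : Finset V} {u v : V} (hv : v ∉ W)
    (h : Reach c P (insert v W) u v) (hu : u ∈ W) : ∃ w ∈ W, Reach c P W u w ∧ P (c w v) := by
  induction h using Relation.ReflTransGen.head_induction_on with
  | refl => exact absurd hu hv
  | @head x y hxy _ ih =>
    by_cases hy : y = v
    · subst hy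
      exact ⟨x, hu, .refl, hxy.2.2⟩
    · have hyW : y ∈ W := by simpa [hy] using hxy.2.1
      obtain ⟨w, hw, hyw, hP⟩ := ih hyW
      exact ⟨w, hw, .head ⟨hu, hyW, hxy.2.2⟩ hyw, hP⟩

/-- If the colors of a Gallai coloring are merged into three classes, then at least one of the
classes does not connect the vertex set. By induction: let `i` be a class disconnected on `W`, and
suppose that all three classes connect `insert v W`. Then `v` has an `i`-neighbor in each
`i`-component of `W`, so a `j`-edge from `v` to a component forces class `j` between that component
and all others. Both other classes occur at `v`, and they conflict. -/
theorem IsGallai.exists_not_reach [DecidableEq V] (hG : IsGallai c) (g : K → Fin 3) (W : Finset V)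
    (hW : W.Nontrivial) : ∃ i, ∃ u ∈ W, ∃ w ∈ W, ¬ Reach c (fun e => g e = i) W u w := by
  induction W using Finset.induction_on with
  | empty => simp at hW
  | @insert v W hv ih =>
    by_contra! hcon
    have hne : W.Nonempty := by
      rw [nonempty_iff_ne_empty]
      rintro rfl
      simp at hW
    have hedge : ∀ i, ∀ u ∈ W, ∃ w ∈ W, Reach c (fun e => g e = i) W u w ∧ g (c w v) = i :=
      fun i u hu => Reach.exists_adj hv
        (hcon i u (mem_insert_of_mem hu) v (mem_insert_self v W)) hu
    by_cases hWn : W.Nontrivial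
    · obtain ⟨i, u, hu, w, hw, huw⟩ := ih hWn
      obtain ⟨j, l, hij, hil, hjl⟩ : ∃ j l : Fin 3, i ≠ j ∧ i ≠ l ∧ j ≠ l := by
        clear * -; revert i; decide
      have htri : ∀ x y j', i ≠ j' → x ∈ W → y ∈ W → ¬ Reach c (fun e => g e = i) W x y →
          g (c x v) = i → g (c y v) = j' → g (c x y) = j' := by
        intro x y j' hj' hx hy hxy h1 h2
        have hxy' : x ≠ y := by rintro rfl; exact hxy .refl
        have h3 : g (c x y) ≠ i := fun h => hxy (.single ⟨hx, hy, h⟩)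
        rcases hG.noRainbow x y v hxy' (ne_of_mem_of_not_mem hy hv)
          (ne_of_mem_of_not_mem hx hv) with h | h | h
        · rw [h, h2]
        · exact absurd (h ▸ h1) h3
        · exact absurd (by rw [← h1, ← h, h2]) hj'
      obtain ⟨y, hy, -, hyv⟩ := hedge j _ hu
      obtain ⟨z, hz, -, hzv⟩ := hedge l _ hu
      by_cases hyz : Reach c (fun e => g e = i) W y z
      · obtain ⟨x, hx, hxy⟩ : ∃ x ∈ W, ¬ Reach c (fun e => g e = i) W x y := by
          by_contra! h
          exact huw ((h u hu).trans (Reach.symm hG (h w hw)))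
        obtain ⟨x', hx', hxx', hx'v⟩ := hedge i x hx
        have h1 : ¬ Reach c (fun e => g e = i) W x' y := fun h => hxy (hxx'.trans h)
        have h2 : ¬ Reach c (fun e => g e = i) W x' z := fun h => h1 (h.trans (hyz.symm hG))
        have h3 := htri x' y j hij hx' hy h1 hx'v hyv
        have h4 := htri x' z l hil hx' hz h2 hx'v hzv
        rw [hG.eq_of_reach hx' h1 hyz] at h3
        exact hjl (h3.symm.trans h4)
      · obtain ⟨y', hy', hyy', hy'v⟩ := hedge i y hy
        obtain ⟨z', hz', hzz', hz'v⟩ := hedge i z hz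
        have h1 : ¬ Reach c (fun e => g e = i) W y' z := fun h => hyz (hyy'.trans h)
        have h2 : ¬ Reach c (fun e => g e = i) W z' y := fun h =>
          hyz (Reach.symm hG (hzz'.trans h))
        have h3 := htri z' y j hij hz' hy h2 hz'v hyv
        have h4 := htri y' z l hil hy' hz h1 hy'v hzv
        have h5 : ¬ Reach c (fun e => g e = i) W y z' := fun h => h2 (h.symm hG)
        have h6 : ¬ Reach c (fun e => g e = i) W z y' := fun h => h1 (h.symm hG)
        rw [hG.symm z' y, ← hG.eq_of_reach hy hyz hzz'] at h3
        rw [hG.symm y' z, ← hG.eq_of_reach hz (fun h => hyz (h.symm hG)) hyy', hG.symm z y] at h4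
        exact hjl (h3.symm.trans h4)
    · obtain ⟨u, hu⟩ := hne
      have hall : ∀ w ∈ W, w = u := fun w hw => by
        by_contra h
        exact hWn ⟨w, hw, u, hu, h⟩
      obtain ⟨w, hw, -, h0⟩ := hedge 0 u hu
      obtain ⟨w', hw', -, h1⟩ := hedge 1 u hu
      rw [hall w hw] at h0
      rw [hall w' hw', h0] at h1
      exact absurd h1 (by decide)

/-! ### Maximal modules -/

theorem IsGallai.isModule_color (hG : IsGallai c) {A : Finset V} (hA : IsModule c A) {a a' y : V}
    (ha : a ∈ A) (ha' : a' ∈ A) (hy : y ∉ A) : c a y = c a' y := by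
  rw [hG.symm a, hG.symm a', hA y hy a ha a' ha']

variable [Fintype V] [DecidableEq V]

theorem exists_isMaxModule (hV : 2 ≤ Fintype.card V) (x : V) :
    ∃ A, x ∈ A ∧ IsMaxModule c A := by
  classical
  obtain ⟨A, hxA, hA⟩ := Finset.exists_le_maximal
    (univ.filter fun A : Finset V => A.Nonempty ∧ IsModule c A ∧ A ≠ univ) (a := {x}) (by
      simp only [mem_filter, mem_univ, true_and, singleton_nonempty]
      refine ⟨?_, ?_⟩
      · intro y _ a ha a' ha'
        rw [mem_singleton.1 ha, mem_singleton.1 ha']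
      · intro h
        have := congrArg Finset.card h
        rw [card_singleton, card_univ] at this
        omega)
  have hA' := (mem_filter.1 hA.prop).2
  refine ⟨A, hxA (mem_singleton_self x), hA'.1, hA'.2.1, hA'.2.2, fun C hC hCu hAC => ?_⟩
  refine (hA.eq_of_le ?_ hAC).symm
  simp [hC, hCu, hA'.1.mono hAC]

/-- Only two colors leave a maximal module `A`. If there were three, some class disconnects the
coloring obtained by contracting `A` to a point, and the component of that point, with `A` put back,
is a larger module. -/
theorem IsMaxModule.card_colors_le [DecidableEq K] (hG : IsGallai c) {A : Finset V}
    (hA : IsMaxModule c A) {a : V} (ha : a ∈ A) : #(Aᶜ.image (c a)) ≤ 2 := by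
  classical
  by_contra! hlt
  obtain ⟨e₀, h₀, e₁, h₁, e₂, h₂, h01, h02, h12⟩ := Finset.two_lt_card.1 hlt
  let g : K → Fin 3 := fun e => if e = e₀ then 0 else if e = e₁ then 1 else 2
  have hg : ∀ i, ∃ x, x ∉ A ∧ g (c a x) = i := by
    have key : ∀ e ∈ Aᶜ.image (c a), ∃ x, x ∉ A ∧ g (c a x) = g e := by
      intro e he
      obtain ⟨x, hx, rfl⟩ := mem_image.1 he
      exact ⟨x, by simpa using hx, rfl⟩
    intro i
    fin_cases i
    · obtain ⟨x, hx, h⟩ := key e₀ h₀; exact ⟨x, hx, h.trans (by simp [g])⟩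
    · obtain ⟨x, hx, h⟩ := key e₁ h₁; exact ⟨x, hx, h.trans (by simp [g, h01.symm])⟩
    · obtain ⟨x, hx, h⟩ := key e₂ h₂; exact ⟨x, hx, h.trans (by simp [g, h02.symm, h12.symm])⟩
  have haW : a ∈ insert a Aᶜ := mem_insert_self _ _
  obtain ⟨i, u, hu, w, hw, huw⟩ := hG.exists_not_reach g (insert a Aᶜ) (by
    obtain ⟨x, hx, -⟩ := hg 0
    exact ⟨a, haW, x, by simp [hx], by rintro rfl; exact hx ha⟩)
  let C : Finset V := univ.filter fun x => x ∈ A ∨ Reach c (fun e => g e = i) (insert a Aᶜ) a x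
  have hC : IsModule c C := by
    have key : ∀ y ∉ C, ∀ x ∈ C, c y x = c y a := by
      intro y hy x hx
      simp only [C, mem_filter, mem_univ, true_and, not_or] at hy hx
      have hyW : y ∈ insert a Aᶜ := by simp [hy.1]
      rcases hx with hx | hx
      · exact hA.isModule y hy.1 x hx a ha
      · exact (hG.eq_of_reach hyW (fun h => hy.2 (h.symm hG)) hx).symm
    intro y hy x hx x' hx'
    rw [key y hy x hx, key y hy x' hx']
  have hCu : C ≠ univ := by
    intro h
    have hr : ∀ x ∈ insert a Aᶜ, Reach c (fun e => g e = i) (insert a Aᶜ) a x := by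
      intro x hx
      have hxC : x ∈ C := h ▸ mem_univ x
      simp only [C, mem_filter, mem_univ, true_and] at hxC
      rcases mem_insert.1 hx with rfl | hx
      · exact .refl
      · exact hxC.resolve_left (by simpa using hx)
    exact huw (((hr u hu).symm hG).trans (hr w hw))
  have hCA := hA.eq_of_subset C hC hCu (fun x hx => by simp [C, hx])
  obtain ⟨x, hx, hgx⟩ := hg i
  refine hx (hCA ▸ ?_)
  simp only [C, mem_filter, mem_univ, true_and]
  exact Or.inr (.single ⟨haW, by simp [hx], hgx⟩)

end

/-! ### Color degrees, sides of a module, and added vertices -/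

/-- Every vertex is incident to at most `d` edges of each color. -/
def ColorDegreeLE {V K : Type*} [Fintype V] [DecidableEq V] [DecidableEq K] (c : V → V → K)
    (d : ℕ) : Prop :=
  ∀ x i, #{y | y ≠ x ∧ c x y = i} ≤ d

/-- The vertices outside `A` are partitioned into `R` and `B`, where `A` is joined to `R` in color
`ρ` only and to `B` in color `β ≠ ρ` only. -/
structure IsSplit {V K : Type*} (c : V → V → K) (A R B : Finset V) (ρ β : K) : Prop where
  ne : ρ ≠ β
  nonempty : A.Nonempty
  cover : ∀ x, x ∈ A ∨ x ∈ R ∨ x ∈ B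
  disjAR : Disjoint A R
  disjAB : Disjoint A B
  red : ∀ a ∈ A, ∀ x ∈ R, c a x = ρ
  blue : ∀ a ∈ A, ∀ x ∈ B, c a x = β

/-- A new vertex is joined to the vertices of `S`, the edge to `u` having color `f u`, so that no
rainbow triangle arises and all color degrees, including that of the new vertex, are at
most `d`. -/
structure IsExtension {V K : Type*} [Fintype V] [DecidableEq V] [DecidableEq K] (c : V → V → K)
    (d : ℕ) (S : Finset V) (f : V → K) : Prop where
  noRainbow : ∀ u ∈ S, ∀ w ∈ S, u ≠ w → f u = f w ∨ c u w = f u ∨ c u w = f w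
  degree_lt : ∀ u ∈ S, #{y | y ≠ u ∧ c u y = f u} + 1 ≤ d
  card_le : ∀ i, #{u ∈ S | f u = i} ≤ d

section

variable {V K : Type*} {c : V → V → K} {A R B : Finset V} {ρ β : K} {d : ℕ}

/-! ### The two sides of a maximal module -/

namespace IsSplit

theorem symm (h : IsSplit c A R B ρ β) : IsSplit c A B R β ρ where
  ne := h.ne.symm
  nonempty := h.nonempty
  cover x := by have := h.cover x; tauto
  disjAR := h.disjAB
  disjAB := h.disjAR
  red := h.blue
  blue := h.red

theorem disjRB (h : IsSplit c A R B ρ β) : Disjoint R B := by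
  obtain ⟨a, ha⟩ := h.nonempty
  rw [Finset.disjoint_left]
  intro x hx hx'
  exact h.ne ((h.red a ha x hx).symm.trans (h.blue a ha x hx'))

theorem cross (hG : IsGallai c) (h : IsSplit c A R B ρ β) {x y : V} (hx : x ∈ R) (hy : y ∈ B) :
    c x y = ρ ∨ c x y = β := by
  obtain ⟨a, ha⟩ := h.nonempty
  have h1 := h.red a ha x hx
  have h2 := h.blue a ha y hy
  rcases hG.noRainbow a x y (fun e => Finset.disjoint_left.1 h.disjAR ha (e ▸ hx))
    (fun e => Finset.disjoint_left.1 h.disjRB hx (e ▸ hy))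
    (fun e => Finset.disjoint_left.1 h.disjAB ha (e ▸ hy)) with e | e | e
  · exact Or.inl (e ▸ h1)
  · exact absurd (h1.symm.trans (e.trans h2)) h.ne
  · exact Or.inr (e.trans h2)

theorem subset_red (h : IsSplit c A R B ρ β) {M : Finset V} (hM : IsModule c M)
    (hAM : Disjoint A M) {x : V} (hxM : x ∈ M) (hxR : x ∈ R) : M ⊆ R := by
  intro y hy
  obtain ⟨a, ha⟩ := h.nonempty
  rcases h.cover y with hyA | hyR | hyB
  · exact absurd hy (Finset.disjoint_left.1 hAM hyA)
  · exact hyR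
  · have := hM a (Finset.disjoint_left.1 hAM ha) x hxM y hy
    rw [h.red a ha x hxR, h.blue a ha y hyB] at this
    exact absurd this h.ne

theorem card_add [Fintype V] (h : IsSplit c A R B ρ β) : #A + #R + #B = Fintype.card V := by
  classical
  rw [← card_union_of_disjoint h.disjAR, ← card_union_of_disjoint
    (disjoint_union_left.2 ⟨h.disjAB, h.disjRB⟩), ← card_univ]
  congr 1
  ext x
  have := h.cover x
  simp only [mem_union, mem_univ, iff_true]
  tauto

/-- Every edge between `R` and `B` has color `ρ` or `β`. -/
theorem card_mul_card [DecidableEq K] (hG : IsGallai c) (h : IsSplit c A R B ρ β) :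
    #R * #B = ∑ x ∈ R, #{y ∈ B | c x y = ρ} + ∑ y ∈ B, #{x ∈ R | c y x = β} := by
  classical
  have h1 := sum_card_bipartiteAbove_eq_sum_card_bipartiteBelow (s := R) (t := B)
    (fun x y => c x y = β)
  simp only [bipartiteAbove, bipartiteBelow] at h1
  have h2 : ∑ y ∈ B, #{x ∈ R | c y x = β} = ∑ y ∈ B, #{x ∈ R | c x y = β} := by
    refine sum_congr rfl fun y _ => ?_
    simp only [hG.symm y]
  rw [h2, ← h1, ← sum_add_distrib, ← smul_eq_mul, ← sum_const]
  refine sum_congr rfl fun x hx => ?_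
  rw [← card_union_of_disjoint]
  · congr 1
    ext y
    simp only [mem_union, mem_filter]
    refine ⟨fun hy => ?_, fun hy => hy.elim And.left And.left⟩
    rcases h.cross hG hx hy with e | e
    · exact Or.inl ⟨hy, e⟩
    · exact Or.inr ⟨hy, e⟩
  · rw [Finset.disjoint_left]
    intro y hy hy'
    simp only [mem_filter] at hy hy'
    exact h.ne (hy.2.symm.trans hy'.2)

end IsSplit

variable [Fintype V] [DecidableEq V] [DecidableEq K]

theorem ColorDegreeLE.card_le (hd : ColorDegreeLE c d) {T : Finset V} {x : V} {i : K} (hx : x ∉ T)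
    (hT : ∀ y ∈ T, c x y = i) : #T ≤ d :=
  (card_le_card fun y hy => by
    simp only [mem_filter, mem_univ, true_and]
    exact ⟨ne_of_mem_of_not_mem hy hx, hT y hy⟩).trans (hd x i)

/-- The vertex set cannot be cut into two parts with a single color between them, because the
vertices of the smaller part would have too large a degree in that color. -/
theorem ColorDegreeLE.not_cut (hG : IsGallai c) (hd : ColorDegreeLE c d)
    (hN : 2 * d < Fintype.card V) {X : Finset V} (hX : X.Nonempty) (hXu : X ≠ univ) (i : K)
    (hi : ∀ x ∈ X, ∀ y ∉ X, c x y = i) : False := by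
  obtain ⟨x, hx⟩ := hX
  obtain ⟨y, hy⟩ : ∃ y, y ∉ X := by
    by_contra! h
    exact hXu (eq_univ_iff_forall.2 h)
  have h1 : #Xᶜ ≤ d := hd.card_le (x := x) (i := i) (by simpa using hx) (fun z hz =>
    hi x hx z (by simpa using hz))
  have h2 : #X ≤ d := hd.card_le (i := i) hy (fun z hz => by rw [hG.symm]; exact hi z hz y hy)
  have := card_add_card_compl X
  omega

theorem IsMaxModule.exists_isSplit (hG : IsGallai c) (hd : ColorDegreeLE c d)
    (hN : 2 * d < Fintype.card V) (hA : IsMaxModule c A) :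
    ∃ R B ρ β, IsSplit c A R B ρ β := by
  obtain ⟨a, ha⟩ := hA.nonempty
  have hle := hA.card_colors_le hG ha
  have h2 : #(Aᶜ.image (c a)) = 2 := by
    refine le_antisymm hle ?_
    by_contra! hlt
    obtain ⟨y, hy⟩ : ∃ y, y ∉ A := by
      by_contra! h
      exact hA.ne_univ (eq_univ_iff_forall.2 h)
    have h1 : #(Aᶜ.image (c a)) ≤ 1 := by omega
    rw [card_le_one] at h1
    refine hd.not_cut hG hN hA.nonempty hA.ne_univ (c a y) fun a' ha' z hz => ?_
    rw [hG.isModule_color hA.isModule ha' ha hz]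
    exact h1 _ (mem_image_of_mem _ (by simpa using hz)) _
      (mem_image_of_mem _ (by simpa using hy))
  obtain ⟨ρ, β, hne, him⟩ := card_eq_two.1 h2
  refine ⟨univ.filter fun x => x ∉ A ∧ c a x = ρ, univ.filter fun x => x ∉ A ∧ c a x = β, ρ, β, hne, hA.nonempty, ?_, ?_, ?_,
    ?_, ?_⟩
  · intro x
    by_cases hx : x ∈ A
    · exact Or.inl hx
    · have : c a x ∈ Aᶜ.image (c a) := mem_image_of_mem _ (by simpa using hx)
      rw [him] at this
      simp only [mem_insert, mem_singleton] at this
      simp only [mem_filter, mem_univ, true_and]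
      tauto
  · rw [Finset.disjoint_left]
    intro x hx hx'
    simp only [mem_filter] at hx'
    exact hx'.2.1 hx
  · rw [Finset.disjoint_left]
    intro x hx hx'
    simp only [mem_filter] at hx'
    exact hx'.2.1 hx
  · intro a' ha' x hx
    simp only [mem_filter, mem_univ, true_and] at hx
    rw [hG.isModule_color hA.isModule ha' ha hx.1, hx.2]
  · intro a' ha' x hx
    simp only [mem_filter, mem_univ, true_and] at hx
    rw [hG.isModule_color hA.isModule ha' ha hx.1, hx.2]

namespace IsSplit

theorem card_red_le (h : IsSplit c A R B ρ β) (hd : ColorDegreeLE c d) : #R ≤ d := by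
  obtain ⟨a, ha⟩ := h.nonempty
  exact hd.card_le (Finset.disjoint_left.1 h.disjAR ha) (h.red a ha)

theorem card_red_nbrs_le (hG : IsGallai c) (h : IsSplit c A R B ρ β) {x : V} (hx : x ∈ R) :
    #A + #{y ∈ B | c x y = ρ} ≤ #{y | y ≠ x ∧ c x y = ρ} := by
  rw [← card_union_of_disjoint (h.disjAB.mono_right (filter_subset _ _))]
  refine card_le_card fun y hy => ?_
  simp only [mem_union, mem_filter, mem_univ, true_and] at hy ⊢
  rcases hy with hy | ⟨hy, hxy⟩
  · exact ⟨ne_of_mem_of_not_mem hy (Finset.disjoint_right.1 h.disjAR hx), by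
      rw [hG.symm, h.red y hy x hx]⟩
  · exact ⟨ne_of_mem_of_not_mem hy (Finset.disjoint_left.1 h.disjRB hx), hxy⟩

theorem card_module_le (hG : IsGallai c) (h : IsSplit c A R B ρ β) (hd : ColorDegreeLE c d)
    (hA : A ≠ univ) : #A ≤ d := by
  obtain ⟨x, hx⟩ : ∃ x, x ∉ A := by
    by_contra! hcon
    exact hA (eq_univ_iff_forall.2 hcon)
  rcases (h.cover x).resolve_left hx with hx | hx
  · have := h.card_red_nbrs_le hG hx
    have := hd x ρ
    omega
  · have := h.symm.card_red_nbrs_le hG hx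
    have := hd x β
    omega

/-- A vertex of `R` sends at most `d - #A` edges of color `ρ` to `B`, and a vertex of `B` at most
`d - #A` edges of color `β` to `R`. -/
theorem card_mul_card_le (hG : IsGallai c) (h : IsSplit c A R B ρ β) (hd : ColorDegreeLE c d) :
    #R * #B ≤ (#R + #B) * (d - #A) := by
  rw [h.card_mul_card hG, add_mul]
  refine add_le_add ?_ ?_
  · rw [← smul_eq_mul]
    refine sum_le_card_nsmul _ _ _ fun x hx => ?_
    have := h.card_red_nbrs_le hG hx
    have := hd x ρ
    omega
  · rw [← smul_eq_mul]
    refine sum_le_card_nsmul _ _ _ fun x hx => ?_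
    have := h.symm.card_red_nbrs_le hG hx
    have := hd x β
    omega

end IsSplit

/-- Distinct maximal modules are disjoint: if two of them overlap, their union is a module, hence
everything, and then a single color joins one to the rest of the other. -/
theorem IsMaxModule.eq_of_mem (hG : IsGallai c) (hd : ColorDegreeLE c d)
    (hN : 2 * d < Fintype.card V) {M : Finset V} (hA : IsMaxModule c A) (hM : IsMaxModule c M)
    {x : V} (hxA : x ∈ A) (hxM : x ∈ M) : A = M := by
  by_cases hAM : A ⊆ M
  · exact (hA.eq_of_subset M hM.isModule hM.ne_univ hAM).symm
  by_cases hMA : M ⊆ A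
  · exact hM.eq_of_subset A hA.isModule hA.ne_univ hMA
  have hC : IsModule c (A ∪ M) := by
    have key : ∀ y ∉ A ∪ M, ∀ z ∈ A ∪ M, c y z = c y x := by
      intro y hy z hz
      simp only [mem_union, not_or] at hy hz
      rcases hz with hz | hz
      · exact hA.isModule y hy.1 z hz x hxA
      · exact hM.isModule y hy.2 z hz x hxM
    intro y hy z hz z' hz'
    rw [key y hy z hz, key y hy z' hz']
  by_cases hu : A ∪ M = univ
  · obtain ⟨y, hyM, hyA⟩ := not_subset.1 hMA
    refine (hd.not_cut hG hN hM.nonempty hM.ne_univ (c y x) fun q hq p hp => ?_).elim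
    have hpA : p ∈ A := (mem_union.1 (hu ▸ mem_univ p)).resolve_right hp
    rw [hG.symm, hM.isModule p hp q hq y hyM, hG.symm, hA.isModule y hyA p hpA x hxA]
  · exact (hA.eq_of_subset _ hC hu subset_union_left).symm.trans
      (hM.eq_of_subset _ hC hu subset_union_right)

theorem IsMaxModule.disjoint (hG : IsGallai c) (hd : ColorDegreeLE c d)
    (hN : 2 * d < Fintype.card V) {M : Finset V} (hA : IsMaxModule c A) (hM : IsMaxModule c M)
    (hne : A ≠ M) : Disjoint A M :=
  Finset.disjoint_left.2 fun _ h1 h2 => hne (hA.eq_of_mem hG hd hN hM h1 h2)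

/-- Two distinct maximal modules have a common neighbor that is joined to both in one color. -/
theorem IsMaxModule.card_add_card_le (hG : IsGallai c) (hd : ColorDegreeLE c d)
    (hN : 2 * d < Fintype.card V) {M : Finset V} (hA : IsMaxModule c A) (hM : IsMaxModule c M)
    (hne : A ≠ M) : #A + #M ≤ d := by
  have hdisj := hA.disjoint hG hd hN hM hne
  obtain ⟨x, hx⟩ := hM.nonempty
  have key : ∀ R B ρ β, IsSplit c A R B ρ β → x ∈ R → #A + #M ≤ d := by
    intro R B ρ β h hxR
    have h1 := h.card_red_nbrs_le hG hxR
    have h2 := hd x ρ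
    have h3 := h.card_add
    have h4 := h.card_red_le hd
    obtain ⟨y, hy, hxy⟩ : ∃ y ∈ B, c x y ≠ ρ := by
      by_contra! hcon
      rw [filter_true_of_mem hcon] at h1
      omega
    have hMR := h.subset_red hM.isModule hdisj hx hxR
    have hyM : y ∉ M := fun hyM => Finset.disjoint_left.1 h.disjRB (hMR hyM) hy
    have hyA : y ∉ A := Finset.disjoint_right.1 h.disjAB hy
    rw [← card_union_of_disjoint hdisj]
    refine hd.card_le (x := y) (i := β) (by simp [hyM, hyA]) fun z hz => ?_
    rcases mem_union.1 hz with hz | hz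
    · rw [hG.symm, h.blue z hz y hy]
    · rw [hM.isModule y hyM z hz x hx, hG.symm, (h.cross hG hxR hy).resolve_left hxy]
  obtain ⟨R, B, ρ, β, h⟩ := hA.exists_isSplit hG hd hN
  rcases h.cover x with hxA | hxR | hxB
  · exact absurd hx (Finset.disjoint_left.1 hdisj hxA)
  · exact key _ _ _ _ h hxR
  · exact key _ _ _ _ h.symm hxB

end

section

variable {V K : Type*} {c : V → V → K} {A R B S : Finset V} {ρ β : K} {d t : ℕ} {f : V → K}
  [Fintype V] [DecidableEq V] [DecidableEq K]

/-! ### Odd stars -/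

/-- For `5 t` vertices and color degrees at most `2 t`, the inequality `IsSplit.card_mul_card_le`
is tight, and it determines the sizes of a maximal module and its two sides. -/
theorem IsSplit.card_eq_of_odd (hG : IsGallai c) (hd : ColorDegreeLE c (2 * t))
    (hV : Fintype.card V = 5 * t) (ht : 1 ≤ t) (hA : A ≠ univ) (h : IsSplit c A R B ρ β) :
    #A = t ∧ #R = 2 * t := by
  have h1 := h.card_add
  have h2 := h.card_red_le hd
  have h3 := h.symm.card_red_le hd
  have h4 := h.card_module_le hG hd hA
  have h5 := h.card_mul_card_le hG hd
  obtain ⟨p, hp⟩ := Nat.exists_eq_add_of_le h2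
  obtain ⟨q, hq⟩ := Nat.exists_eq_add_of_le h3
  obtain ⟨s, hs⟩ := Nat.exists_eq_add_of_le h4
  rw [hs, Nat.add_sub_cancel_left] at h5
  have h6 : #A = t + p + q := by omega
  have h7 : t = s + p + q := by omega
  have h8 : #R = 2 * s + p + 2 * q := by omega
  have h9 : #B = 2 * s + 2 * p + q := by omega
  rw [h8, h9] at h5
  have h10 : p + q = 0 := by
    by_contra hne
    have : 1 ≤ p + q := by omega
    nlinarith [Nat.zero_le (p * q), Nat.zero_le (s * p), Nat.zero_le (s * q)]
  omega

/-- A vertex of a maximal module `A` already has full degree in both colors leaving `A`. -/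
theorem IsExtension.color_ne_of_odd (hG : IsGallai c) (hd : ColorDegreeLE c (2 * t))
    (hV : Fintype.card V = 5 * t) (ht : 1 ≤ t) (hf : IsExtension c (2 * t) S f)
    (hA : IsMaxModule c A) {u w : V} (huS : u ∈ S) (hu : u ∈ A) (hw : w ∉ A) : c u w ≠ f u := by
  have key : ∀ R B ρ β, IsSplit c A R B ρ β → w ∈ R → c u w ≠ f u := by
    intro R B ρ β h hwR heq
    have h1 := (h.card_eq_of_odd hG hd hV ht hA.ne_univ).2
    have h2 := hf.degree_lt u huS
    have h3 : #R ≤ #{y | y ≠ u ∧ c u y = f u} := card_le_card fun y hy => by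
      simp only [mem_filter, mem_univ, true_and]
      exact ⟨ne_of_mem_of_not_mem hy (Finset.disjoint_left.1 h.disjAR hu), by
        rw [← heq, h.red u hu y hy, h.red u hu w hwR]⟩
    omega
  obtain ⟨R, B, ρ, β, h⟩ := hA.exists_isSplit hG hd (by omega)
  rcases (h.cover w).resolve_left hw with hw | hw
  · exact key _ _ _ _ h hw
  · exact key _ _ _ _ h.symm hw

/-- If two edges from the new vertex have different colors, then their ends lie in one maximal
module, and so does the whole of `S`; but a module has only `t` vertices. -/
theorem IsExtension.false_of_odd (hG : IsGallai c) (hd : ColorDegreeLE c (2 * t))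
    (hV : Fintype.card V = 5 * t) (ht : 1 ≤ t) (hf : IsExtension c (2 * t) S f)
    (hS : #S = 2 * t + 1) : False := by
  have hsame : ∀ A, IsMaxModule c A → ∀ u ∈ S, ∀ w ∈ S, u ∈ A → w ∉ A → f u = f w := by
    intro A hA u hu w hw huA hwA
    obtain ⟨M, hwM, hM⟩ := exists_isMaxModule (c := c) (by omega) w
    have huM : u ∉ M := fun huM => hwA (by
      rwa [hA.eq_of_mem hG hd (by omega) hM huA huM])
    rcases hf.noRainbow u hu w hw (ne_of_mem_of_not_mem huA hwA) with h | h | h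
    · exact h
    · exact absurd h (hf.color_ne_of_odd hG hd hV ht hA hu huA hwA)
    · rw [hG.symm] at h
      exact absurd h (hf.color_ne_of_odd hG hd hV ht hM hw hwM huM)
  obtain ⟨u, hu⟩ : S.Nonempty := by rw [← card_pos]; omega
  obtain ⟨A, huA, hA⟩ := exists_isMaxModule (c := c) (by omega) u
  obtain ⟨w, hw, hne⟩ : ∃ w ∈ S, f w ≠ f u := by
    by_contra! h
    have := hf.card_le (f u)
    rw [filter_true_of_mem h] at this
    omega
  have hwA : w ∈ A := by
    by_contra hwA
    exact hne (hsame A hA u hu w hw huA hwA).symm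
  obtain ⟨R, B, ρ, β, h⟩ := hA.exists_isSplit hG hd (by omega)
  have hcard := (h.card_eq_of_odd hG hd hV ht hA.ne_univ).1
  obtain ⟨z, hz, hzA⟩ : ∃ z ∈ S, z ∉ A := by
    by_contra! hsub
    have := card_le_card (show S ⊆ A from hsub)
    omega
  exact hne ((hsame A hA w hw z hz hwA hzA).trans (hsame A hA u hu z hz huA hzA).symm)

/-! ### Even stars -/

theorem IsSplit.card_bounds_of_even (hG : IsGallai c) (hd : ColorDegreeLE c (2 * t + 1))
    (hV : Fintype.card V = 5 * t + 1) (ht : 5 ≤ t) (hA : A ≠ univ) (h : IsSplit c A R B ρ β) :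
    t ≤ #A + 1 ∧ #A ≤ t + 1 := by
  have h1 := h.card_add
  have h2 := h.card_red_le hd
  have h3 := h.symm.card_red_le hd
  have h4 := h.card_module_le hG hd hA
  have h5 := h.card_mul_card_le hG hd
  refine ⟨by omega, ?_⟩
  by_contra! hlt
  obtain ⟨p, hp⟩ := Nat.exists_eq_add_of_le h2
  obtain ⟨q, hq⟩ := Nat.exists_eq_add_of_le h3
  obtain ⟨s, hs⟩ := Nat.exists_eq_add_of_le h4
  obtain ⟨e, he⟩ := Nat.exists_eq_add_of_lt hlt
  rw [hs, Nat.add_sub_cancel_left] at h5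
  have h6 : t = s + 1 + e := by omega
  have h7 : (#R : ℤ) = 2 * t + 1 - p := by omega
  have h8 : (#B : ℤ) = 2 * t + 1 - q := by omega
  have h9 : (q : ℤ) = e + 3 - p := by omega
  have h10 : (s : ℤ) = t - 1 - e := by omega
  have h11 : (#R : ℤ) * #B ≤ (#R + #B) * s := by exact_mod_cast h5
  have h12 : (0 : ℤ) ≤ p * q := by positivity
  have h13 : (0 : ℤ) ≤ e * s := by positivity
  have h14 : (0 : ℤ) ≤ e * t := by positivity
  have h15 : (11 : ℤ) * e ≤ (2 * t + 1) * e := by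
    refine mul_le_mul_of_nonneg_right ?_ (by positivity)
    omega
  -- With `D = 2 t + 1`, the inequality `h11` reads `D e + p q + (3 + e) s ≤ 0`.
  have h16 : ((2 : ℤ) * t + 1) * e + p * q + (3 + e) * s ≤ 0 := by
    rw [h7, h8] at h11
    rw [h9] at h11 ⊢
    rw [h10] at h11 ⊢
    nlinarith
  have h17 : (e : ℤ) + s = t - 1 := by omega
  nlinarith

/-- A side of a maximal module is made up of at most two maximal modules, because three of them
would have at least `3 (t - 1) > 2 t + 1` vertices. -/
theorem IsSplit.card_red_le_of_even (hG : IsGallai c) (hd : ColorDegreeLE c (2 * t + 1))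
    (hV : Fintype.card V = 5 * t + 1) (ht : 5 ≤ t) (hA : IsMaxModule c A)
    (h : IsSplit c A R B ρ β) (hM : ∀ M, IsMaxModule c M → M ⊆ R → #M ≤ t) : #R ≤ 2 * t := by
  have hN : 2 * (2 * t + 1) < Fintype.card V := by omega
  have hmod : ∀ x ∈ R, ∃ M, x ∈ M ∧ IsMaxModule c M ∧ M ⊆ R ∧ t ≤ #M + 1 ∧ #M ≤ t := by
    intro x hx
    obtain ⟨M, hxM, hMm⟩ := exists_isMaxModule (c := c) (by omega) x
    have hne : A ≠ M := by
      rintro rfl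
      exact Finset.disjoint_left.1 h.disjAR hxM hx
    have hMR := h.subset_red hMm.isModule (hA.disjoint hG hd hN hMm hne) hxM hx
    obtain ⟨R', B', ρ', β', h'⟩ := hMm.exists_isSplit hG hd hN
    exact ⟨M, hxM, hMm, hMR, (h'.card_bounds_of_even hG hd hV ht hMm.ne_univ).1, hM M hMm hMR⟩
  rcases R.eq_empty_or_nonempty with rfl | ⟨x, hx⟩
  · simp
  obtain ⟨M₁, hx₁, hM₁, hR₁, hl₁, hu₁⟩ := hmod x hx
  by_cases hc₁ : R ⊆ M₁
  · have := card_le_card hc₁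
    omega
  obtain ⟨y, hy, hyM⟩ := not_subset.1 hc₁
  obtain ⟨M₂, hy₂, hM₂, hR₂, hl₂, hu₂⟩ := hmod y hy
  have h12 : Disjoint M₁ M₂ := hM₁.disjoint hG hd hN hM₂ (by rintro rfl; exact hyM hy₂)
  by_cases hc₂ : R ⊆ M₁ ∪ M₂
  · have := card_le_card hc₂
    rw [card_union_of_disjoint h12] at this
    omega
  obtain ⟨z, hz, hzM⟩ := not_subset.1 hc₂
  simp only [mem_union, not_or] at hzM
  obtain ⟨M₃, hz₃, hM₃, hR₃, hl₃, hu₃⟩ := hmod z hz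
  have h13 : Disjoint M₁ M₃ := hM₁.disjoint hG hd hN hM₃ (by rintro rfl; exact hzM.1 hz₃)
  have h23 : Disjoint M₂ M₃ := hM₂.disjoint hG hd hN hM₃ (by rintro rfl; exact hzM.2 hz₃)
  have h4 := card_le_card (union_subset (union_subset hR₁ hR₂) hR₃)
  rw [card_union_of_disjoint (disjoint_union_left.2 ⟨h13, h23⟩), card_union_of_disjoint h12] at h4
  have := h.card_red_le hd
  omega

/-- Some maximal module has `t + 1` vertices; both of its sides then have `2 t` vertices. -/
theorem exists_isSplit_of_even (hG : IsGallai c) (hd : ColorDegreeLE c (2 * t + 1))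
    (hV : Fintype.card V = 5 * t + 1) (ht : 5 ≤ t) :
    ∃ A R B ρ β, IsSplit c A R B ρ β ∧ #A = t + 1 ∧ #R = 2 * t ∧ #B = 2 * t := by
  have hN : 2 * (2 * t + 1) < Fintype.card V := by omega
  obtain ⟨A, hA, hcard⟩ : ∃ A, IsMaxModule c A ∧ #A = t + 1 := by
    by_contra! hcon
    have hle : ∀ M, IsMaxModule c M → #M ≤ t := by
      intro M hM
      obtain ⟨R, B, ρ, β, h⟩ := hM.exists_isSplit hG hd hN
      have := (h.card_bounds_of_even hG hd hV ht hM.ne_univ).2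
      have := hcon M hM
      omega
    obtain ⟨x⟩ : Nonempty V := by rw [← Fintype.card_pos_iff]; omega
    obtain ⟨A, -, hA⟩ := exists_isMaxModule (c := c) (by omega) x
    obtain ⟨R, B, ρ, β, h⟩ := hA.exists_isSplit hG hd hN
    have h1 := h.card_red_le_of_even hG hd hV ht hA fun M hM _ => hle M hM
    have h2 := h.symm.card_red_le_of_even hG hd hV ht hA fun M hM _ => hle M hM
    have h3 := h.card_add
    have h4 := hle A hA
    omega
  obtain ⟨R, B, ρ, β, h⟩ := hA.exists_isSplit hG hd hN
  have hle : ∀ M, IsMaxModule c M → A ≠ M → #M ≤ t := by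
    intro M hM hne
    have := hA.card_add_card_le hG hd hN hM hne
    omega
  have hne : ∀ R : Finset V, Disjoint A R → ∀ M, M ⊆ R → A ≠ M := by
    rintro R hdisj M hMR rfl
    obtain ⟨a, ha⟩ := h.nonempty
    exact Finset.disjoint_left.1 hdisj ha (hMR ha)
  have h1 := h.card_red_le_of_even hG hd hV ht hA fun M hM hMR => hle M hM (hne R h.disjAR M hMR)
  have h2 := h.symm.card_red_le_of_even hG hd hV ht hA
    fun M hM hMR => hle M hM (hne B h.disjAB M hMR)
  have h3 := h.card_add
  exact ⟨A, R, B, ρ, β, h, hcard, by omega, by omega⟩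

/-- With these sizes the count of the edges between `R` and `B` is tight, so the vertices of `R`
have no room for a further edge of color `ρ`. -/
theorem IsSplit.color_ne_red (hG : IsGallai c) (hd : ColorDegreeLE c (2 * t + 1))
    (hf : IsExtension c (2 * t + 1) S f) (h : IsSplit c A R B ρ β) (hA : #A = t + 1)
    (hR : #R = 2 * t) (hB : #B = 2 * t) {x : V} (hx : x ∈ R) (hxS : x ∈ S) : f x ≠ ρ := by
  intro hfx
  have h0 := hf.degree_lt x hxS
  rw [hfx] at h0
  have hlt : ∑ x ∈ R, #{y ∈ B | c x y = ρ} < ∑ _x ∈ R, t := by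
    refine sum_lt_sum (fun y hy => ?_) ⟨x, hx, ?_⟩
    · have := h.card_red_nbrs_le hG hy
      have := hd y ρ
      omega
    · have := h.card_red_nbrs_le hG hx
      omega
  have hle : ∑ y ∈ B, #{x ∈ R | c y x = β} ≤ ∑ _y ∈ B, t := by
    refine sum_le_sum fun y hy => ?_
    have := h.symm.card_red_nbrs_le hG hy
    have := hd y β
    omega
  have hmul := h.card_mul_card hG
  rw [sum_const, smul_eq_mul] at hlt hle
  rw [hR, hB] at hmul
  rw [hR] at hlt
  rw [hB] at hle
  nlinarith

theorem IsSplit.exists_blue_nbr (hG : IsGallai c) (hd : ColorDegreeLE c (2 * t + 1))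
    (hV : Fintype.card V = 5 * t + 1) (hS : #S = 4 * t + 2)
    (h : IsSplit c A R B ρ β) (hA : #A = t + 1) (hB : #B = 2 * t) {x : V} (hx : x ∈ R) :
    ∃ y ∈ B, y ∈ S ∧ c x y = β := by
  by_contra! hcon
  have h1 := h.card_red_nbrs_le hG hx
  have h2 := hd x ρ
  have h3 : B ⊆ B.filter (fun y => c x y = ρ) ∪ Sᶜ := by
    intro y hy
    simp only [mem_union, mem_filter, mem_compl]
    by_cases hyS : y ∈ S
    · exact Or.inl ⟨hy, (h.cross hG hx hy).resolve_right (hcon y hy hyS)⟩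
    · exact Or.inr hyS
  have h4 := (card_le_card h3).trans (card_union_le _ _)
  have h5 := card_add_card_compl S
  omega

/-- The new vertex has exactly `2 t + 1` edges in each of the two colors `ρ` and `β`, hence edges
`va` of color `ρ` and `va'` of color `β` to `A`. The color of `aa'` is then one of these two, which
gives `a` or `a'` too large a degree. -/
theorem IsExtension.false_of_even (hG : IsGallai c) (hd : ColorDegreeLE c (2 * t + 1))
    (hV : Fintype.card V = 5 * t + 1) (ht : 5 ≤ t) (hf : IsExtension c (2 * t + 1) S f)
    (hS : #S = 4 * t + 2) : False := by
  obtain ⟨A, R, B, ρ, β, h, hA, hR, hB⟩ := exists_isSplit_of_even hG hd hV ht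
  have hRf : ∀ x ∈ R, x ∈ S → f x ≠ ρ := fun x hx hxS =>
    h.color_ne_red hG hd hf hA hR hB hx hxS
  have hBf : ∀ x ∈ B, x ∈ S → f x ≠ β := fun x hx hxS =>
    h.symm.color_ne_red hG hd hf hA hB hR hx hxS
  have hmeet : ∀ T : Finset V, t ≤ #T → ∃ x ∈ T, x ∈ S := by
    intro T hT
    by_contra! hcon
    have h1 := card_le_card (show T ⊆ Sᶜ from fun x hx => mem_compl.2 (hcon x hx))
    have h2 := card_add_card_compl S
    omega
  obtain ⟨a₀, ha₀, ha₀S⟩ := hmeet A (by omega)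
  obtain ⟨x₀, hx₀, hx₀S⟩ := hmeet R (by omega)
  obtain ⟨y₀, hy₀, hy₀S⟩ := hmeet B (by omega)
  have hAR : ∀ a ∈ A, a ∈ S → ∀ x ∈ R, x ∈ S → f a = f x ∨ f a = ρ := by
    intro a ha haS x hx hxS
    rcases hf.noRainbow a haS x hxS
      (ne_of_mem_of_not_mem ha (Finset.disjoint_right.1 h.disjAR hx)) with e | e | e
    · exact Or.inl e
    · exact Or.inr (by rw [← e, h.red a ha x hx])
    · exact absurd (by rw [← e, h.red a ha x hx]) (hRf x hx hxS)
  have hAB : ∀ a ∈ A, a ∈ S → ∀ x ∈ B, x ∈ S → f a = f x ∨ f a = β := by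
    intro a ha haS x hx hxS
    rcases hf.noRainbow a haS x hxS
      (ne_of_mem_of_not_mem ha (Finset.disjoint_right.1 h.disjAB hx)) with e | e | e
    · exact Or.inl e
    · exact Or.inr (by rw [← e, h.blue a ha x hx])
    · exact absurd (by rw [← e, h.blue a ha x hx]) (hBf x hx hxS)
  have hAf : ∀ a ∈ A, a ∈ S → f a = ρ ∨ f a = β := by
    intro a ha haS
    by_contra! hcon
    have hR' : ∀ x ∈ R, x ∈ S → f x = f a := fun x hx hxS =>
      ((hAR a ha haS x hx hxS).resolve_right hcon.1).symm
    have hB' : ∀ x ∈ B, x ∈ S → f x = f a := fun x hx hxS =>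
      ((hAB a ha haS x hx hxS).resolve_right hcon.2).symm
    have hall : ∀ x ∈ S, f x = f a := by
      intro x hxS
      rcases h.cover x with hx | hx | hx
      · rcases hAR x hx hxS x₀ hx₀ hx₀S with e | e
        · exact e.trans (hR' x₀ hx₀ hx₀S)
        · rcases hAB x hx hxS y₀ hy₀ hy₀S with e' | e'
          · exact e'.trans (hB' y₀ hy₀ hy₀S)
          · exact absurd (e.symm.trans e') h.ne
      · exact hR' x hx hxS
      · exact hB' x hx hxS
    have := hf.card_le (f a)
    rw [filter_true_of_mem hall] at this
    omega
  have hRβ : ∀ x ∈ R, x ∈ S → f x = β := by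
    intro x hx hxS
    by_contra hne
    obtain ⟨y, hy, hyS, hxy⟩ := h.exists_blue_nbr hG hd hV hS hA hB hx
    have hfy : f x = f y := by
      rcases hf.noRainbow x hxS y hyS
        (ne_of_mem_of_not_mem hx (Finset.disjoint_right.1 h.disjRB hy)) with e | e | e
      · exact e
      · exact absurd (e.symm.trans hxy) hne
      · exact absurd (e.symm.trans hxy) (hBf y hy hyS)
    have h1 := hAR a₀ ha₀ ha₀S x hx hxS
    have h2 := hAB a₀ ha₀ ha₀S y hy hyS
    have h3 := hAf a₀ ha₀ ha₀S
    have h4 := hRf x hx hxS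
    have h5 := h.ne
    grind
  have hBρ : ∀ x ∈ B, x ∈ S → f x = ρ := by
    intro x hx hxS
    by_contra hne
    obtain ⟨y, hy, hyS, hxy⟩ := h.symm.exists_blue_nbr hG hd hV hS hA hR hx
    have hfy : f x = f y := by
      rcases hf.noRainbow x hxS y hyS
        (ne_of_mem_of_not_mem hx (Finset.disjoint_left.1 h.disjRB hy)) with e | e | e
      · exact e
      · exact absurd (e.symm.trans hxy) hne
      · exact absurd (e.symm.trans hxy) (hRf y hy hyS)
    exact hBf x hx hxS (hfy.trans (hRβ y hy hyS))
  have hsplit : S.filter (fun u => f u = ρ) ∪ S.filter (fun u => f u = β) = S := by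
    rw [← filter_or, filter_true_of_mem]
    intro x hxS
    rcases h.cover x with hx | hx | hx
    · exact hAf x hx hxS
    · exact Or.inr (hRβ x hx hxS)
    · exact Or.inl (hBρ x hx hxS)
  have hcard := card_union_le (S.filter fun u => f u = ρ) (S.filter fun u => f u = β)
  rw [hsplit] at hcard
  have hρ := hf.card_le ρ
  have hβ := hf.card_le β
  obtain ⟨a, ha, haS, hfa⟩ : ∃ a ∈ A, a ∈ S ∧ f a = ρ := by
    by_contra! hcon
    have hsub : S.filter (fun u => f u = ρ) ⊆ B := by
      intro x hx
      rw [mem_filter] at hx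
      rcases h.cover x with hx' | hx' | hx'
      · exact absurd hx.2 (hcon x hx' hx.1)
      · exact absurd hx.2 (hRf x hx' hx.1)
      · exact hx'
    have := card_le_card hsub
    omega
  obtain ⟨a', ha', ha'S, hfa'⟩ : ∃ a ∈ A, a ∈ S ∧ f a = β := by
    by_contra! hcon
    have hsub : S.filter (fun u => f u = β) ⊆ R := by
      intro x hx
      rw [mem_filter] at hx
      rcases h.cover x with hx' | hx' | hx'
      · exact absurd hx.2 (hcon x hx' hx.1)
      · exact hx'
      · exact absurd hx.2 (hBf x hx' hx.1)
    have := card_le_card hsub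
    omega
  have haa' : a ≠ a' := by
    rintro rfl
    exact h.ne (hfa.symm.trans hfa')
  have hdeg : ∀ b ∈ A, ∀ b' ∈ A, b ∈ S → b ≠ b' → ∀ T : Finset V, Disjoint A T → #T = 2 * t →
      (∀ x ∈ T, c b x = f b) → c b b' ≠ f b := by
    intro b hb b' hb' hbS hbb' T hAT hT hcol heq
    have h1 := hf.degree_lt b hbS
    have h2 : #(insert b' T) ≤ #{y | y ≠ b ∧ c b y = f b} := card_le_card fun y hy => by
      simp only [mem_filter, mem_univ, true_and]
      rcases mem_insert.1 hy with rfl | hy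
      · exact ⟨hbb'.symm, heq⟩
      · exact ⟨ne_of_mem_of_not_mem hy (Finset.disjoint_left.1 hAT hb), hcol y hy⟩
    rw [card_insert_of_notMem (Finset.disjoint_left.1 hAT hb')] at h2
    omega
  rcases hf.noRainbow a haS a' ha'S haa' with e | e | e
  · exact h.ne (hfa.symm.trans (e.trans hfa'))
  · exact hdeg a ha a' ha' haS haa' R h.disjAR hR
      (fun x hx => by rw [h.red a ha x hx, hfa]) e
  · exact hdeg a' ha' a ha ha'S haa'.symm B h.disjAB hB
      (fun x hx => by rw [h.blue a' ha' x hx, hfa']) (by rw [hG.symm]; exact e)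

end

/-! ### Stars and copies -/

theorem starK_isContained_iff {V : Type*} {H : SimpleGraph V} {m : ℕ} :
    (starK m).IsContained H ↔ ∃ x, ∃ T : Finset V, #T = m ∧ ∀ y ∈ T, H.Adj x y := by
  constructor
  · rintro ⟨φ⟩
    refine ⟨φ (Sum.inl 0), univ.map ⟨fun j => φ (Sum.inr j), fun a b hab =>
      Sum.inr_injective (φ.injective hab)⟩, by simp, ?_⟩
    intro y hy
    obtain ⟨j, -, rfl⟩ := mem_map.1 hy
    exact φ.toHom.map_adj (by simp)
  · rintro ⟨x, T, hT, hadj⟩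
    let e : Fin m ≃ T := (T.equivFinOfCardEq hT).symm
    refine ⟨⟨⟨Sum.elim (fun _ => x) (fun j => (e j : V)), ?_⟩, ?_⟩⟩
    · rintro (a | a) (b | b) hab
      · simp at hab
      · exact hadj _ (e b).2
      · exact (hadj _ (e a).2).symm
      · simp at hab
    · rintro (a | a) (b | b) hab
      · rw [Subsingleton.elim a b]
      · exact absurd hab (hadj _ (e b).2).ne
      · exact absurd hab (hadj _ (e a).2).ne'
      · exact congrArg Sum.inr (e.injective (Subtype.ext hab))

theorem GallaiArrows.of_copy {V V' : Type*} {G : SimpleGraph V} {G' : SimpleGraph V'} {k : ℕ}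
    {W : Fin k → Type*} {H : ∀ i, SimpleGraph (W i)} (h : GallaiArrows G H)
    (φ : SimpleGraph.Copy G G') : GallaiArrows G' H := by
  intro c
  rcases h (c.pullback φ.toHom) with ⟨x, y, z, hxy, hyz, hxz, h1, h2, h3⟩ | ⟨i, hi⟩
  · exact Or.inl ⟨φ x, φ y, φ z, φ.toHom.map_adj hxy, φ.toHom.map_adj hyz, φ.toHom.map_adj hxz,
      h1, h2, h3⟩
  · refine Or.inr ⟨i, hi.trans ⟨⟨⟨φ, fun {a b} hab => ?_⟩, φ.injective⟩⟩⟩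
    rw [SimpleGraph.EdgeLabeling.labelGraph_adj] at hab ⊢
    obtain ⟨hab, hc⟩ := hab
    exact ⟨φ.toHom.map_adj hab, hc⟩

/-- A single graph `K_N ⊔ K_{1,s-1}` that does not arrow bounds both numbers from below, and the
graphs `K_N ⊔ K_{1,s}` bound both from above. -/
theorem isStarCriticalGallaiRamseyNumber_of_arrows {k N s : ℕ} {W : Fin k → Type*}
    {H : ∀ i, SimpleGraph (W i)} (hs : s ≤ N)
    (hup : ∀ S : Finset (Fin N), #S = s → GallaiArrows (completeAddVertex N S) H)
    {S₀ : Finset (Fin N)} (hS₀ : s ≤ #S₀ + 1) (hlow : ¬ GallaiArrows (completeAddVertex N S₀) H) :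
    IsStarCriticalGallaiRamseyNumber H s := by
  refine ⟨N + 1, ⟨?_, ?_⟩, ⟨hs, hup⟩, ?_⟩
  · obtain ⟨S, -, hS⟩ := exists_subset_card_eq (s := (univ : Finset (Fin N))) (n := s) (by simpa)
    refine (hup S hS).of_copy ⟨⟨fun o => (finSuccEquiv N).symm o, fun {a b} hab => ?_⟩,
      (finSuccEquiv N).symm.injective⟩
    rw [SimpleGraph.top_adj]
    exact (finSuccEquiv N).symm.injective.ne hab.ne
  · intro n hn
    by_contra! hlt
    refine hlow (GallaiArrows.of_copy hn ⟨⟨fun a => some (Fin.castLE (by omega) a), ?_⟩, ?_⟩)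
    · intro a b hab
      exact fun h => hab (Fin.castLE_injective _ h)
    · intro a b hab
      exact Fin.castLE_injective _ (Option.some_injective _ hab)
  · rintro s' ⟨-, hs'⟩
    by_contra! hlt
    obtain ⟨S, hSS, hS⟩ := exists_subset_card_eq (s := S₀) (n := s') (by omega)
    refine hlow ((hs' S hS).of_copy (SimpleGraph.Copy.ofLE _ _ ?_))
    rintro (_ | a) (_ | b) hab
    · exact hab
    · exact hSS hab
    · exact hSS hab
    · exact hab

theorem gallaiArrows_completeAddVertex {k N d : ℕ} (hk : 0 < k) {S : Finset (Fin N)}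
    (h : ∀ c : Fin N → Fin N → Fin k, IsGallai c → ColorDegreeLE c d →
      ∀ f, IsExtension c d S f → False) :
    GallaiArrows (completeAddVertex N S) (fun _ : Fin k => starK (d + 1)) := by
  intro C
  by_contra! hcon
  obtain ⟨hrb, hstar⟩ := hcon
  have hdeg : ∀ x i, ∀ T : Finset (Option (Fin N)), (∀ y ∈ T, (C.labelGraph i).Adj x y) →
      #T ≤ d := by
    intro x i T hT
    by_contra! hlt
    obtain ⟨T', hT', hcard⟩ := exists_subset_card_eq (s := T) (n := d + 1) hlt
    exact not_isEmpty_iff.2 (starK_isContained_iff.2 ⟨x, T', hcard, fun y hy => hT y (hT' hy)⟩) (hstar i)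
  have hadj : ∀ a b : Fin N, a ≠ b → (completeAddVertex N S).Adj (some a) (some b) :=
    fun a b hab => hab
  have hnone : ∀ b ∈ S, (completeAddVertex N S).Adj none (some b) := fun b hb => hb
  let c : Fin N → Fin N → Fin k := fun a b =>
    if hab : a ≠ b then C.get (some a) (some b) (hadj a b hab) else ⟨0, hk⟩
  let f : Fin N → Fin k := fun b =>
    if hb : b ∈ S then C.get none (some b) (hnone b hb) else ⟨0, hk⟩
  have hc : ∀ a b (hab : a ≠ b), c a b = C.get (some a) (some b) (hadj a b hab) :=
    fun a b hab => dif_pos hab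
  have hf : ∀ b (hb : b ∈ S), f b = C.get none (some b) (hnone b hb) := fun b hb => dif_pos hb
  have hcl : ∀ a b i, a ≠ b → c a b = i → (C.labelGraph i).Adj (some a) (some b) := by
    intro a b i hab hi
    rw [SimpleGraph.EdgeLabeling.labelGraph_adj]
    exact ⟨hadj a b hab, by rw [← hi, hc a b hab]; rfl⟩
  have hfl : ∀ b i, b ∈ S → f b = i → (C.labelGraph i).Adj none (some b) := by
    intro b i hb hi
    rw [SimpleGraph.EdgeLabeling.labelGraph_adj]
    exact ⟨hnone b hb, by rw [← hi, hf b hb]; rfl⟩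
  have hsymm : ∀ a b, c a b = c b a := by
    intro a b
    by_cases hab : a = b
    · rw [hab]
    · rw [hc a b hab, hc b a (Ne.symm hab), SimpleGraph.EdgeLabeling.get_comm]
  refine h c ⟨hsymm, ?_⟩ ?_ f ⟨?_, ?_, ?_⟩
  · intro x y z hxy hyz hxz
    rw [hc x y hxy, hc y z hyz, hc x z hxz]
    by_contra! hne
    exact hrb ⟨some x, some y, some z, hadj x y hxy, hadj y z hyz, hadj x z hxz, hne⟩
  · intro x i
    rw [← card_map Function.Embedding.some]
    refine hdeg (some x) i _ fun y hy => ?_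
    simp only [mem_map, mem_filter, mem_univ, true_and, Function.Embedding.some_apply] at hy
    obtain ⟨z, ⟨hzx, hi⟩, rfl⟩ := hy
    exact hcl x z i hzx.symm hi
  · intro u hu w hw huw
    rw [hf u hu, hf w hw, hc u w huw]
    by_contra! hne
    exact hrb ⟨none, some u, some w, hnone u hu, hadj u w huw, hnone w hw, hne.2.1.symm, hne.1,
      hne.2.2⟩
  · intro u hu
    rw [← card_insertNone]
    refine hdeg (some u) (f u) _ fun y hy => ?_
    rcases y with _ | y
    · exact (hfl u _ hu rfl).symm
    · simp only [some_mem_insertNone, mem_filter, mem_univ, true_and] at hy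
      exact hcl u y _ hy.1.symm hy.2
  · intro i
    rw [← card_map Function.Embedding.some]
    refine hdeg none i _ fun y hy => ?_
    simp only [mem_map, mem_filter, Function.Embedding.some_apply] at hy
    obtain ⟨z, ⟨hz, hi⟩, rfl⟩ := hy
    exact hfl z i hz hi

/-! ### The extremal colorings -/

theorem not_gallaiArrows_of_coloring {V : Type*} {G : SimpleGraph V} {k m : ℕ} (hk : 3 ≤ k)
    (col : V → V → Fin 3) (hsymm : ∀ x y, col y x = col x y)
    (hrb : ∀ x y z, G.Adj x y → G.Adj y z → G.Adj x z →
      col x y = col y z ∨ col x y = col x z ∨ col y z = col x z)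
    (hdeg : ∀ x j, ∃ T : Finset V, #T < m ∧ ∀ y, G.Adj x y → col x y = j → y ∈ T) :
    ¬ GallaiArrows G (fun _ : Fin k => starK m) := by
  intro h
  rcases h (SimpleGraph.EdgeLabeling.mk (fun x y _ => Fin.castLE hk (col x y))
    (fun x y _ => by rw [hsymm])) with ⟨x, y, z, hxy, hyz, hxz, h1, h2, h3⟩ | ⟨i, hi⟩
  · simp only [SimpleGraph.EdgeLabeling.get_mk, ne_eq, Fin.castLE_inj] at h1 h2 h3
    rcases hrb x y z hxy hyz hxz with h | h | h
    exacts [h1 h, h2 h, h3 h]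
  · obtain ⟨x, T', hT', hadj⟩ := starK_isContained_iff.1 hi
    have hadj' : ∀ y ∈ T', G.Adj x y ∧ Fin.castLE hk (col x y) = i := by
      intro y hy
      have := hadj y hy
      rw [SimpleGraph.EdgeLabeling.labelGraph_adj] at this
      exact ⟨this.1, this.2⟩
    obtain ⟨T₀, hT₀, -⟩ := hdeg x 0
    obtain ⟨y₀, hy₀⟩ : T'.Nonempty := by rw [← card_pos]; omega
    obtain ⟨T, hT, hsub⟩ := hdeg x (col x y₀)
    have : T' ⊆ T := fun y hy => hsub y (hadj' y hy).1 (Fin.castLE_injective hk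
      ((hadj' y hy).2.trans (hadj' y₀ hy₀).2.symm))
    have := card_le_card this
    omega

/-- The pentagon coloring: residues modulo `5` at distance `1` get color `0`, residues at
distance `2` get color `1`, and equal residues get color `2`. -/
def pentagonColor (x y : ℕ) : Fin 3 :=
  if x % 5 = y % 5 then 2
  else if (x + 1) % 5 = y % 5 ∨ (y + 1) % 5 = x % 5 then 0 else 1

theorem pentagonColor_comm (x y : ℕ) : pentagonColor y x = pentagonColor x y := by
  unfold pentagonColor
  grind

theorem pentagonColor_noRainbow (x y z : ℕ) : pentagonColor x y = pentagonColor y z ∨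
    pentagonColor x y = pentagonColor x z ∨ pentagonColor y z = pentagonColor x z := by
  unfold pentagonColor
  grind

theorem pentagonColor_eq_zero {x y : ℕ} (h : pentagonColor x y = 0) :
    y % 5 = (x + 1) % 5 ∨ y % 5 = (x + 4) % 5 := by
  unfold pentagonColor at h
  split_ifs at h <;> omega

theorem pentagonColor_eq_one {x y : ℕ} (h : pentagonColor x y = 1) :
    y % 5 = (x + 2) % 5 ∨ y % 5 = (x + 3) % 5 := by
  unfold pentagonColor at h
  split_ifs at h <;> omega

theorem pentagonColor_eq_two {x y : ℕ} (h : pentagonColor x y = 2) : y % 5 = x % 5 := by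
  unfold pentagonColor at h
  split_ifs at h <;> omega

/-- The vertices of residue `r` modulo `5`. -/
def residueClass (N r : ℕ) : Finset (Fin N) := {y | (y : ℕ) % 5 = r}

theorem mem_residueClass {N r : ℕ} {y : Fin N} : y ∈ residueClass N r ↔ (y : ℕ) % 5 = r := by
  simp [residueClass]

theorem card_residueClass_le {N r q : ℕ} (h : N ≤ 5 * q + r) : #(residueClass N r) ≤ q := by
  rw [← card_range q]
  refine card_le_card_of_injOn (fun y => (y : ℕ) / 5) ?_ ?_
  · intro y hy
    have := mem_residueClass.1 (mem_coe.1 hy)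
    simp only [coe_range, Set.mem_Iio]
    omega
  · intro y hy z hz hyz
    have h1 := mem_residueClass.1 (mem_coe.1 hy)
    have h2 := mem_residueClass.1 (mem_coe.1 hz)
    simp only at hyz
    exact Fin.ext (by omega)

/-- The blow-up of the pentagon with five parts of size `t`, and a new vertex with `2 t` edges of
the color `2` that is used inside the parts. -/
theorem not_gallaiArrows_of_odd {k t : ℕ} (hk : 3 ≤ k) (ht : 1 ≤ t) {S : Finset (Fin (5 * t))}
    (hS : #S = 2 * t) :
    ¬ GallaiArrows (completeAddVertex (5 * t) S) (fun _ : Fin k => starK (2 * t + 1)) := by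
  let col : Option (Fin (5 * t)) → Option (Fin (5 * t)) → Fin 3
    | some a, some b => pentagonColor a b
    | _, _ => 2
  have hle : ∀ r, #(residueClass (5 * t) r) ≤ t := fun r => card_residueClass_le (by omega)
  have hle2 : ∀ r r', #(residueClass (5 * t) r ∪ residueClass (5 * t) r') < 2 * t + 1 := by
    intro r r'
    have := card_union_le (residueClass (5 * t) r) (residueClass (5 * t) r')
    have := hle r
    have := hle r'
    omega
  refine not_gallaiArrows_of_coloring hk col ?_ ?_ ?_
  · rintro (_ | a) (_ | b) <;> first | rfl | exact pentagonColor_comm _ _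
  · rintro (_ | a) (_ | b) (_ | e) hab hbe hae
    all_goals first
      | exact hab.elim
      | exact hbe.elim
      | exact hae.elim
      | exact pentagonColor_noRainbow _ _ _
      | exact Or.inl rfl
      | exact Or.inr (Or.inl rfl)
      | exact Or.inr (Or.inr rfl)
  · rintro (_ | a) j
    · refine ⟨S.map Function.Embedding.some, by rw [card_map]; omega, ?_⟩
      rintro (_ | b) hb -
      · exact hb.elim
      · exact mem_map_of_mem _ hb
    · fin_cases j
      · refine ⟨(residueClass _ ((a + 1) % 5) ∪ residueClass _ ((a + 4) % 5)).map
          Function.Embedding.some, by rw [card_map]; exact hle2 _ _, ?_⟩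
        rintro (_ | b) hb hc
        · exact absurd (show (2 : Fin 3) = _ from hc) (by decide)
        · refine mem_map_of_mem _ ?_
          rw [mem_union, mem_residueClass, mem_residueClass]
          exact pentagonColor_eq_zero hc
      · refine ⟨(residueClass _ ((a + 2) % 5) ∪ residueClass _ ((a + 3) % 5)).map
          Function.Embedding.some, by rw [card_map]; exact hle2 _ _, ?_⟩
        rintro (_ | b) hb hc
        · exact absurd (show (2 : Fin 3) = _ from hc) (by decide)
        · refine mem_map_of_mem _ ?_
          rw [mem_union, mem_residueClass, mem_residueClass]
          exact pentagonColor_eq_one hc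
      · refine ⟨insertNone (residueClass _ (a % 5)), ?_, ?_⟩
        · rw [card_insertNone]
          have := hle (a % 5)
          omega
        · rintro (_ | b) hb hc
          · exact none_mem_insertNone
          · rw [some_mem_insertNone, mem_residueClass]
            exact pentagonColor_eq_two hc

/-- The blow-up of the pentagon in which the part of residue `0` has `t + 1` vertices and the others
have `t`. The new vertex is joined to the parts `1` and `4` in color `1`, to the parts `2` and `3`
in color `0`, and to a single vertex of the part `0`, in color `0`. -/
theorem not_gallaiArrows_of_even {k t : ℕ} (hk : 3 ≤ k) :
    ¬ GallaiArrows (completeAddVertex (5 * t + 1) {b | (b : ℕ) % 5 = 0 → (b : ℕ) = 0})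
      (fun _ : Fin k => starK (2 * t + 2)) := by
  let new : ℕ → Fin 3 := fun b => if b % 5 = 1 ∨ b % 5 = 4 then 1 else 0
  let col : Option (Fin (5 * t + 1)) → Option (Fin (5 * t + 1)) → Fin 3
    | some a, some b => pentagonColor a b
    | none, some b => new b
    | some a, none => new a
    | none, none => 0
  have hnew : ∀ a b : Fin (5 * t + 1), a ≠ b → ((a : ℕ) % 5 = 0 → (a : ℕ) = 0) →
      ((b : ℕ) % 5 = 0 → (b : ℕ) = 0) →
      new a = new b ∨ new a = pentagonColor a b ∨ new b = pentagonColor a b := by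
    intro a b hab ha hb
    have hab' : (a : ℕ) ≠ b := fun h => hab (Fin.ext h)
    simp only [new, pentagonColor]
    grind
  let P := residueClass (5 * t + 1)
  have hmemP : ∀ (b : Fin (5 * t + 1)) r, b ∈ P r ↔ (b : ℕ) % 5 = r := fun b r => mem_residueClass
  have hle0 : ∀ r, #(P r) ≤ t + 1 := fun r => card_residueClass_le (by omega)
  have hle : ∀ r, r ≠ 0 → #(P r) ≤ t := fun r hr => card_residueClass_le (by omega)
  have hsome : ∀ r r', r' ≠ 0 → #((P r ∪ P r').map Function.Embedding.some) < 2 * t + 2 := by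
    intro r r' hr'
    rw [card_map]
    have := card_union_le (P r) (P r')
    have := hle0 r
    have := hle r' hr'
    omega
  have hnone : ∀ r r', r ≠ 0 → r' ≠ 0 → #(insertNone (P r ∪ P r')) < 2 * t + 2 := by
    intro r r' hr hr'
    rw [card_insertNone]
    have := card_union_le (P r) (P r')
    have := hle r hr
    have := hle r' hr'
    omega
  have hnone' : ∀ r r' j, r ≠ 0 → r' ≠ 0 → ∀ a : Fin (5 * t + 1),
      (∀ b : ℕ, pentagonColor a b = j → b % 5 = r ∨ b % 5 = r') →
      ∃ T : Finset (Option (Fin (5 * t + 1))), #T < 2 * t + 2 ∧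
        ∀ y, (completeAddVertex (5 * t + 1) {b | (b : ℕ) % 5 = 0 → (b : ℕ) = 0}).Adj (some a) y →
          col (some a) y = j → y ∈ T := by
    intro r r' j hr hr' a hcol
    refine ⟨_, hnone r r' hr hr', ?_⟩
    rintro (_ | b) - hc
    · exact none_mem_insertNone
    · rw [some_mem_insertNone, mem_union, hmemP, hmemP]
      exact hcol b hc
  have hsome' : ∀ r r' j, r' ≠ 0 → ∀ a : Fin (5 * t + 1), new a ≠ j →
      (∀ b : ℕ, pentagonColor a b = j → b % 5 = r ∨ b % 5 = r') →
      ∃ T : Finset (Option (Fin (5 * t + 1))), #T < 2 * t + 2 ∧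
        ∀ y, (completeAddVertex (5 * t + 1) {b | (b : ℕ) % 5 = 0 → (b : ℕ) = 0}).Adj (some a) y →
          col (some a) y = j → y ∈ T := by
    intro r r' j hr' a hj hcol
    refine ⟨_, hsome r r' hr', ?_⟩
    rintro (_ | b) - hc
    · exact absurd hc hj
    · refine mem_map_of_mem _ ?_
      rw [mem_union, hmemP, hmemP]
      exact hcol b hc
  refine not_gallaiArrows_of_coloring hk col ?_ ?_ ?_
  · rintro (_ | a) (_ | b) <;> first | rfl | exact pentagonColor_comm _ _
  · rintro (_ | a) (_ | b) (_ | e) hab hbe hae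
    · exact hab.elim
    · exact hab.elim
    · exact hae.elim
    · have h := hnew b e hbe (by simpa using (mem_filter.1 hab).2)
        (by simpa using (mem_filter.1 hae).2)
      change new b = pentagonColor b e ∨ new b = new e ∨ pentagonColor b e = new e
      grind
    · exact hbe.elim
    · have h := hnew a e hae (by simpa using (mem_filter.1 hab).2)
        (by simpa using (mem_filter.1 hbe).2)
      change new a = new e ∨ new a = pentagonColor a e ∨ new e = pentagonColor a e
      grind
    · have h := hnew a b hab (by simpa using (mem_filter.1 hae).2)
        (by simpa using (mem_filter.1 hbe).2)
      change pentagonColor a b = new b ∨ pentagonColor a b = new a ∨ new b = new a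
      grind
    · exact pentagonColor_noRainbow _ _ _
  · rintro (_ | a) j
    · by_cases hj : j = 0
      · refine ⟨(insert 0 (P 2 ∪ P 3)).map Function.Embedding.some, ?_, ?_⟩
        · rw [card_map]
          have := card_insert_le 0 (P 2 ∪ P 3)
          have := card_union_le (P 2) (P 3)
          have := hle 2 (by omega)
          have := hle 3 (by omega)
          omega
        · rintro (_ | b) hb hc
          · exact hb.elim
          · have hb' : (b : ℕ) % 5 = 0 → (b : ℕ) = 0 := by simpa using (mem_filter.1 hb).2
            change new b = j at hc
            refine mem_map_of_mem _ ?_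
            rw [mem_insert, mem_union, hmemP, hmemP, Fin.ext_iff]
            simp only [new, hj] at hc
            have : ¬ ((b : ℕ) % 5 = 1 ∨ (b : ℕ) % 5 = 4) := fun h => by simp [h] at hc
            simp only [Fin.val_zero]
            omega
      · refine ⟨_, hsome 1 4 (by omega), ?_⟩
        rintro (_ | b) hb hc
        · exact hb.elim
        · change new b = j at hc
          refine mem_map_of_mem _ ?_
          rw [mem_union, hmemP, hmemP]
          by_contra h
          simp only [new, h, if_false] at hc
          exact hj hc.symm
    · have hr : (a : ℕ) % 5 = 0 ∨ (a : ℕ) % 5 = 1 ∨ (a : ℕ) % 5 = 2 ∨ (a : ℕ) % 5 = 3 ∨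
          (a : ℕ) % 5 = 4 := by omega
      fin_cases j
      · have h0 := fun b : ℕ => pentagonColor_eq_zero (x := a) (y := b)
        rcases hr with hr | hr | hr | hr | hr
        · exact hnone' 1 4 0 (by omega) (by omega) a fun b hb => by have := h0 b hb; omega
        · exact hsome' 0 2 0 (by omega) a (by simp [new, hr]) fun b hb => by
            have := h0 b hb; omega
        · exact hnone' 1 3 0 (by omega) (by omega) a fun b hb => by have := h0 b hb; omega
        · exact hnone' 2 4 0 (by omega) (by omega) a fun b hb => by have := h0 b hb; omega
        · exact hsome' 0 3 0 (by omega) a (by simp [new, hr]) fun b hb => by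
            have := h0 b hb; omega
      · have h1 := fun b : ℕ => pentagonColor_eq_one (x := a) (y := b)
        rcases hr with hr | hr | hr | hr | hr
        · exact hnone' 2 3 1 (by omega) (by omega) a fun b hb => by have := h1 b hb; omega
        · exact hnone' 3 4 1 (by omega) (by omega) a fun b hb => by have := h1 b hb; omega
        · exact hsome' 0 4 1 (by omega) a (by simp [new, hr]) fun b hb => by
            have := h1 b hb; omega
        · exact hsome' 0 1 1 (by omega) a (by simp [new, hr]) fun b hb => by
            have := h1 b hb; omega
        · exact hnone' 1 2 1 (by omega) (by omega) a fun b hb => by have := h1 b hb; omega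
      · refine ⟨(P (a % 5)).map Function.Embedding.some, ?_, ?_⟩
        · rw [card_map]
          have := hle0 (a % 5)
          omega
        · rintro (_ | b) - hc
          · change new a = 2 at hc
            simp only [new] at hc
            split_ifs at hc <;> simp at hc
          · refine mem_map_of_mem _ ?_
            rw [hmemP]
            exact pentagonColor_eq_two hc

theorem card_even_nbrs_ge (t : ℕ) :
    4 * t + 1 ≤ #({b | (b : ℕ) % 5 = 0 → (b : ℕ) = 0} : Finset (Fin (5 * t + 1))) := by
  have h1 := card_add_card_compl
    ({b | (b : ℕ) % 5 = 0 → (b : ℕ) = 0} : Finset (Fin (5 * t + 1)))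
  rw [Fintype.card_fin] at h1
  have h2 : ({b | (b : ℕ) % 5 = 0 → (b : ℕ) = 0} : Finset (Fin (5 * t + 1)))ᶜ ⊆
      (residueClass (5 * t + 1) 0).erase 0 := by
    intro b hb
    simp only [mem_compl, mem_filter, mem_univ, true_and, Classical.not_imp] at hb
    rw [mem_erase, mem_residueClass]
    exact ⟨fun h => hb.2 (by rw [h]; rfl), hb.1⟩
  have h3 := card_le_card h2
  rw [card_erase_of_mem (mem_residueClass.2 (by simp))] at h3
  have h4 : #(residueClass (5 * t + 1) 0) ≤ t + 1 := card_residueClass_le (by omega)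
  omega

theorem theorem4p2 (k : ℕ) (hk : 3 ≤ k) (m : ℕ) :
    (Odd m → 3 ≤ m →
      IsStarCriticalGallaiRamseyNumber (fun _ : Fin k => starK m) m) ∧
    (Even m → 12 ≤ m →
      IsStarCriticalGallaiRamseyNumber (fun _ : Fin k => starK m) (2 * m - 2)) := by
  constructor
  · rintro ⟨t, rfl⟩ hm
    obtain ⟨S₀, -, hS₀⟩ := exists_subset_card_eq (s := (univ : Finset (Fin (5 * t))))
      (n := 2 * t) (by rw [card_univ, Fintype.card_fin]; omega)
    refine isStarCriticalGallaiRamseyNumber_of_arrows (N := 5 * t) (by omega) (fun S hS => ?_)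
      (by omega) (not_gallaiArrows_of_odd hk (by omega) hS₀)
    exact gallaiArrows_completeAddVertex (by omega) fun c hG hd f hf =>
      hf.false_of_odd hG hd (Fintype.card_fin _) (by omega) hS
  · intro hm hm'
    obtain ⟨t, rfl⟩ : ∃ t, m = 2 * t + 2 := by
      obtain ⟨r, rfl⟩ := hm
      exact ⟨r - 1, by omega⟩
    have hcard := card_even_nbrs_ge t
    refine isStarCriticalGallaiRamseyNumber_of_arrows (N := 5 * t + 1) (by omega) (fun S hS => ?_)
      (by omega) (not_gallaiArrows_of_even hk)
    exact gallaiArrows_completeAddVertex (d := 2 * t + 1) (by omega) fun c hG hd f hf =>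
      hf.false_of_even hG hd (Fintype.card_fin _) (by omega) (by omega)
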